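/- Let $q\ge 1$, and let $A=(a_1,\dots,a_q)$ and $B=(b_1,\dots,b_q)$ be real tuples such that $B$ is weakly supermajorized by $A$, that is, $0<a_1\le a_2\le\dots\le a_q$, $0<b_1\le b_2\le\dots\le b_q$ and $$\sum_{i=1}^k a_i\le\sum_{i=1}^k b_i\qquad (k=1,2,\dots,q).$$ Let $\sigma>0$. With $(a)_0=1$ and $(a)_n=a(a+1)\cdots(a+n-1)$ for $n\ge1$, the series $$\sum_{n=0}^\infty\frac{(\sigma)_n(a_1)_n\cdots(a_q)_n}{(b_1)_n\cdots(b_q)_n\,n!}\,z^n$$ converges for $|z|<1$, and its sum extends analytically to $\mathbb C\setminus[1,\infty)$. Denote this extension by ${}_{q+1}F_q(\sigma,A;B;z)$. Then for every real $x>-1$ the number ${}_{q+1}F_q(\sigma,A;B;-x)$ is real and $$\frac{1}{\left(1+x\prod_{i=1}^q (a_i/b_i)\right)^{\sigma}}\le {}_{q+1}F_q(\sigma,A;B;-x).$$ Equality holds if and only if $x=0$ or $A=B$. -/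

import Mathlib

open scoped BigOperators

/-- `B` is weakly supermajorized by `A`: both tuples are positive and listed in nondecreasing
order, and every partial sum of `A` is at most the corresponding partial sum of `B`. -/
def WeaklySupermajorizedBy {q : ℕ} (B A : Fin q → ℝ) : Prop :=
  (∀ i, 0 < A i) ∧ Monotone A ∧ (∀ i, 0 < B i) ∧ Monotone B ∧
    ∀ k : Fin q, ∑ i ∈ Finset.Iic k, A i ≤ ∑ i ∈ Finset.Iic k, B i

/-- The coefficient `(σ)_n (a_1)_n ⋯ (a_q)_n / ((b_1)_n ⋯ (b_q)_n n!)` of the generalized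
hypergeometric series, where `(a)_n` is the rising factorial. -/
noncomputable def hypergeometricCoeff {q : ℕ} (σ : ℂ) (A B : Fin q → ℂ) (n : ℕ) : ℂ :=
  ((ascPochhammer ℂ n).eval σ * ∏ i, (ascPochhammer ℂ n).eval (A i)) /
    ((∏ i, (ascPochhammer ℂ n).eval (B i)) * (n.factorial : ℂ))

/-- The complex plane cut along the ray `[1, ∞)`. -/
def cutPlane : Set ℂ := {z | z.re < 1 ∨ z.im ≠ 0}

/-- `F` is analytic in the plane cut along `[1, ∞)` and is the sum of the hypergeometric series
in the open unit disk. -/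
def IsHypergeometricContinuation {q : ℕ} (σ : ℂ) (A B : Fin q → ℂ) (F : ℂ → ℂ) : Prop :=
  AnalyticOnNhd ℂ F cutPlane ∧
    ∀ z : ℂ, ‖z‖ < 1 → HasSum (fun n : ℕ => hypergeometricCoeff σ A B n * z ^ n) (F z)

theorem starConvex_cutPlane : StarConvex ℝ (0 : ℂ) cutPlane := by
  rw [starConvex_zero_iff]
  intro z hz t ht0 ht1
  simp only [cutPlane, Set.mem_ofPred_eq, Complex.smul_re, Complex.smul_im, smul_eq_mul] at *
  rcases hz with hz | hz
  · left
    rcases le_or_gt z.re 0 with h | h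
    · nlinarith
    · nlinarith
  · rcases ht0.eq_or_lt with h | h
    · left
      simp [← h]
    · right
      exact mul_ne_zero h.ne' hz

/-- The analytic continuation to the cut plane is unique. -/
theorem IsHypergeometricContinuation.eqOn {q : ℕ} {σ : ℂ} {A B : Fin q → ℂ} {F G : ℂ → ℂ}
    (hF : IsHypergeometricContinuation σ A B F) (hG : IsHypergeometricContinuation σ A B G) :
    Set.EqOn F G cutPlane := by
  have h0 : (0 : ℂ) ∈ cutPlane := by simp [cutPlane]
  refine hF.1.eqOn_of_preconnected_of_eventuallyEq hG.1
    ((starConvex_cutPlane.isPathConnected h0).isConnected.isPreconnected) h0 ?_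
  filter_upwards [Metric.ball_mem_nhds (0 : ℂ) one_pos] with z hz
  have hz' : ‖z‖ < 1 := by simpa using hz
  exact (hF.2 z hz').unique (hG.2 z hz')

open Classical in
/-- The generalized hypergeometric function `_{q+1}F_q(σ, A; B; z)`: the analytic continuation of
the hypergeometric series from the unit disk to the plane cut along `[1, ∞)` (and `0` everywhere
if there were no such continuation). -/
noncomputable def hypergeometric {q : ℕ} (σ : ℂ) (A B : Fin q → ℂ) : ℂ → ℂ :=
  if h : ∃ F : ℂ → ℂ, IsHypergeometricContinuation σ A B F then h.choose else 0

/-- On the cut plane, `hypergeometric` is the continuation whenever there is one. -/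
theorem hypergeometric_eqOn {q : ℕ} {σ : ℂ} {A B : Fin q → ℂ} {F : ℂ → ℂ}
    (hF : IsHypergeometricContinuation σ A B F) :
    Set.EqOn (hypergeometric σ A B) F cutPlane := by
  have h : ∃ F : ℂ → ℂ, IsHypergeometricContinuation σ A B F := ⟨F, hF⟩
  rw [hypergeometric, dif_pos h]
  exact h.choose_spec.eqOn hF

open Filter Topology MeasureTheory Polynomial

/-! Put `m n = ∏ (a i)_n / (b i)_n`. If `m` is the moment sequence of a probability measure `μ` on
`[0, 1]`, integrating the binomial series termwise identifies the hypergeometric function with `∫ (1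
- z t) ^ (-σ) dμ(t)`, which is analytic on the whole cut plane. At `z = -x` the inequality is
Jensen's for the convex function `u ^ (-σ)`, because the mean of `μ` is `m 1 = ∏ a i / b i`.

By Hausdorff's theorem (`CompletelyMonotoneSeq.exists_probabilityMeasure`), such a `μ` exists once
`m` is completely monotone. Here `m n` is the product of `exp (-g j)` over `j < n`, where `g j` sums
`log (b i + j) - log (a i + j)`. Products of this kind inherit complete monotonicity from `g`
(`CompletelyMonotoneSeq.prod_exp_neg`). The `k`-th difference of `g` compares a decreasing convex
function, the `k`-th difference of `-log`, at the two tuples, so majorization makes it nonnegative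
(`sum_negLogDiff_sub_nonneg`).

For `A ≠ B` strict convexity gives `g 1 < g 0`, hence `m 2 ≠ (m 1) ^ 2`: `μ` is not a point mass,
and Jensen is strict when `x ≠ 0`. -/

/-! ### Completely monotone sequences -/

/-- The backward-signed difference `m n - m (n + 1)` of a real sequence. -/
def seqDiff (m : ℕ → ℝ) (n : ℕ) : ℝ := m n - m (n + 1)

/-- The first `k` iterated differences of the sequence are nonnegative. -/
def MonotoneUpTo (k : ℕ) (m : ℕ → ℝ) : Prop := ∀ l ≤ k, ∀ n, 0 ≤ seqDiff^[l] m n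

/-- A completely monotone sequence: all iterated differences are nonnegative. -/
def CompletelyMonotoneSeq (m : ℕ → ℝ) : Prop := ∀ l n, 0 ≤ seqDiff^[l] m n

theorem seqDiff_iterate_add (l : ℕ) (f g : ℕ → ℝ) :
    seqDiff^[l] (f + g) = seqDiff^[l] f + seqDiff^[l] g := by
  induction l generalizing f g with
  | zero => rfl
  | succ l ih =>
    have : seqDiff (f + g) = seqDiff f + seqDiff g := by
      ext n; simp only [seqDiff, Pi.add_apply]; ring
    simp only [Function.iterate_succ_apply, this, ih]

theorem seqDiff_iterate_const_mul (l : ℕ) (c : ℝ) (f : ℕ → ℝ) (n : ℕ) :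
    seqDiff^[l] (fun n => c * f n) n = c * seqDiff^[l] f n := by
  induction l generalizing n with
  | zero => rfl
  | succ l ih =>
    simp only [Function.iterate_succ_apply', seqDiff, ih]; ring

theorem seqDiff_iterate_shift (l : ℕ) (f : ℕ → ℝ) (n : ℕ) :
    seqDiff^[l] (fun n => f (n + 1)) n = seqDiff^[l] f (n + 1) := by
  induction l generalizing n with
  | zero => rfl
  | succ l ih => simp only [Function.iterate_succ_apply', seqDiff, ih]

theorem CompletelyMonotoneSeq.monotoneUpTo {m : ℕ → ℝ} (h : CompletelyMonotoneSeq m) (k : ℕ) :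
    MonotoneUpTo k m := fun l _ n => h l n

theorem MonotoneUpTo.seqDiff {k : ℕ} {m : ℕ → ℝ} (h : MonotoneUpTo (k + 1) m) :
    MonotoneUpTo k (seqDiff m) := fun l hl n => by
  simpa only [Function.iterate_succ_apply] using h (l + 1) (by omega) n

theorem MonotoneUpTo.shift {k : ℕ} {m : ℕ → ℝ} (h : MonotoneUpTo k m) :
    MonotoneUpTo k (fun n => m (n + 1)) := fun l hl n => by
  rw [seqDiff_iterate_shift]; exact h l hl _

theorem MonotoneUpTo.mono {k l : ℕ} {m : ℕ → ℝ} (h : MonotoneUpTo k m) (hl : l ≤ k) :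
    MonotoneUpTo l m := fun j hj n => h j (hj.trans hl) n

theorem monotoneUpTo_succ {k : ℕ} {m : ℕ → ℝ} (h0 : ∀ n, 0 ≤ m n)
    (h : MonotoneUpTo k (seqDiff m)) : MonotoneUpTo (k + 1) m := by
  intro l hl n
  cases l with
  | zero => exact h0 n
  | succ l => rw [Function.iterate_succ_apply]; exact h l (by omega) n

theorem MonotoneUpTo.add {k : ℕ} {f g : ℕ → ℝ} (hf : MonotoneUpTo k f) (hg : MonotoneUpTo k g) :
    MonotoneUpTo k (f + g) := fun l hl n => by
  rw [seqDiff_iterate_add]; exact add_nonneg (hf l hl n) (hg l hl n)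

/-- The Leibniz rule `Δ(f g) = Δf · g + f(· + 1) · Δg` lowers the order by one, so induction on the
order works; this is why monotonicity is tracked up to a finite order. -/
theorem MonotoneUpTo.mul {k : ℕ} {f g : ℕ → ℝ} (hf : MonotoneUpTo k f) (hg : MonotoneUpTo k g) :
    MonotoneUpTo k (f * g) := by
  induction k generalizing f g with
  | zero =>
    intro l hl n
    obtain rfl : l = 0 := by omega
    exact mul_nonneg (hf 0 le_rfl n) (hg 0 le_rfl n)
  | succ k ih =>
    refine monotoneUpTo_succ
      (fun n => mul_nonneg (hf 0 (Nat.zero_le _) n) (hg 0 (Nat.zero_le _) n)) ?_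
    have : _root_.seqDiff (f * g) =
        _root_.seqDiff f * g + (fun n => f (n + 1)) * _root_.seqDiff g := by
      ext n; simp only [_root_.seqDiff, Pi.add_apply, Pi.mul_apply]; ring
    rw [this]
    exact (ih hf.seqDiff (hg.mono k.le_succ)).add (ih (hf.shift.mono k.le_succ) hg.seqDiff)

theorem CompletelyMonotoneSeq.mul {f g : ℕ → ℝ} (hf : CompletelyMonotoneSeq f)
    (hg : CompletelyMonotoneSeq g) : CompletelyMonotoneSeq (f * g) :=
  fun l n => (hf.monotoneUpTo l).mul (hg.monotoneUpTo l) l le_rfl n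

theorem completelyMonotoneSeq_one : CompletelyMonotoneSeq 1 := by
  have h0 : seqDiff 1 = 0 := by ext n; simp [seqDiff]
  have h1 : ∀ l, seqDiff^[l] 0 = 0 := fun l =>
    Function.iterate_fixed (by ext n; simp [seqDiff]) l
  intro l n
  cases l with
  | zero => exact zero_le_one
  | succ l => rw [Function.iterate_succ_apply, h0, h1]; exact le_rfl

theorem CompletelyMonotoneSeq.pow {f : ℕ → ℝ} (hf : CompletelyMonotoneSeq f) (N : ℕ) :
    CompletelyMonotoneSeq (f ^ N) := by
  induction N with
  | zero => rw [pow_zero]; exact completelyMonotoneSeq_one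
  | succ N ih => rw [pow_succ]; exact ih.mul hf

theorem tendsto_seqDiff_iterate {ι : Type*} {F : Filter ι} {f : ι → ℕ → ℝ} {g : ℕ → ℝ}
    (h : ∀ n, Tendsto (fun i => f i n) F (𝓝 (g n))) (l n : ℕ) :
    Tendsto (fun i => seqDiff^[l] (f i) n) F (𝓝 (seqDiff^[l] g n)) := by
  induction l generalizing n with
  | zero => exact h n
  | succ l ih =>
    simp only [Function.iterate_succ_apply', seqDiff]
    exact (ih n).sub (ih (n + 1))

theorem CompletelyMonotoneSeq.of_tendsto {ι : Type*} {F : Filter ι} [F.NeBot] {f : ι → ℕ → ℝ}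
    {g : ℕ → ℝ} (h : ∀ n, Tendsto (fun i => f i n) F (𝓝 (g n)))
    (hf : ∀ᶠ i in F, CompletelyMonotoneSeq (f i)) : CompletelyMonotoneSeq g := fun l n =>
  ge_of_tendsto (tendsto_seqDiff_iterate h l n) (hf.mono fun _ hi => hi l n)

/-- A nonnegative sequence whose consecutive ratios are `1 - g n`, with `g` completely monotone,
is completely monotone. -/
theorem CompletelyMonotoneSeq.prod_one_sub {g : ℕ → ℝ} (hg : CompletelyMonotoneSeq g)
    (h1 : ∀ n, g n ≤ 1) : CompletelyMonotoneSeq fun n => ∏ j ∈ Finset.range n, (1 - g j) := by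
  have h0 : ∀ n, 0 ≤ ∏ j ∈ Finset.range n, (1 - g j) := fun n =>
    Finset.prod_nonneg fun j _ => sub_nonneg.2 (h1 j)
  have key : ∀ k, MonotoneUpTo k fun n => ∏ j ∈ Finset.range n, (1 - g j) := by
    intro k
    induction k with
    | zero =>
      intro l hl n
      obtain rfl : l = 0 := by omega
      exact h0 n
    | succ k ih =>
      refine monotoneUpTo_succ h0 ?_
      -- The difference of the product is the product times `g`, so order `k` for the product yields
      -- order `k + 1`.
      have : seqDiff (fun n => ∏ j ∈ Finset.range n, (1 - g j)) =
          (fun n => ∏ j ∈ Finset.range n, (1 - g j)) * g := by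
        ext n; simp only [seqDiff, Pi.mul_apply, Finset.prod_range_succ]; ring
      rw [this]
      exact ih.mul (hg.monotoneUpTo k)
  exact fun l n => key l l le_rfl n

theorem CompletelyMonotoneSeq.le_zero {g : ℕ → ℝ} (hg : CompletelyMonotoneSeq g) (n : ℕ) :
    g n ≤ g 0 := by
  refine antitone_nat_of_succ_le (fun n => ?_) (Nat.zero_le n)
  have := hg 1 n
  simp only [Function.iterate_one, seqDiff] at this
  linarith

/-- Since `exp (-g) = lim (1 - g / N) ^ N`, the product is a pointwise limit of `N`-th powers of
products covered by `prod_one_sub`, which applies as soon as `N ≥ g 0`, the largest value of `g`. -/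
theorem CompletelyMonotoneSeq.prod_exp_neg {g : ℕ → ℝ} (hg : CompletelyMonotoneSeq g) :
    CompletelyMonotoneSeq fun n => ∏ j ∈ Finset.range n, Real.exp (-g j) := by
  refine CompletelyMonotoneSeq.of_tendsto (F := atTop)
    (f := fun N : ℕ => (fun n => ∏ j ∈ Finset.range n, (1 - (N : ℝ)⁻¹ * g j)) ^ N) ?_ ?_
  · intro n
    simp only [Pi.pow_apply, ← Finset.prod_pow]
    refine tendsto_finsetProd _ fun j _ => ?_
    refine (Real.tendsto_one_add_div_pow_exp (-g j)).congr fun N => ?_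
    congr 1; ring
  · filter_upwards [eventually_gt_atTop 0, eventually_ge_atTop ⌈g 0⌉₊] with N hN0 hN
    have hN0' : (0 : ℝ) < N := by exact_mod_cast hN0
    refine (CompletelyMonotoneSeq.prod_one_sub (g := fun j => (N : ℝ)⁻¹ * g j) ?_ ?_).pow N
    · intro l n
      rw [seqDiff_iterate_const_mul]
      exact mul_nonneg (by positivity) (hg l n)
    · intro n
      rw [inv_mul_le_one₀ hN0']
      exact (hg.le_zero n).trans (Nat.ceil_le.1 hN)

/-! ### The Hausdorff moment theorem -/

/-- The linear functional on polynomials with prescribed moments. -/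
noncomputable def momentFunctional (m : ℕ → ℝ) : ℝ[X] →ₗ[ℝ] ℝ :=
  Polynomial.lsum fun n => m n • LinearMap.id

theorem momentFunctional_X_pow (m : ℕ → ℝ) (n : ℕ) : momentFunctional m (X ^ n) = m n := by
  simp [momentFunctional, ← monomial_one_right_eq_X_pow]

/-- Multiplying by `1 - X` under the functional differences the moments. Complete monotonicity is
thus nonnegativity on all `X ^ k * (1 - X) ^ l`, in particular on Bernstein polynomials. -/
theorem momentFunctional_X_pow_mul (m : ℕ → ℝ) (k l : ℕ) :
    momentFunctional m (X ^ k * (1 - X) ^ l) = seqDiff^[l] m k := by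
  induction l generalizing k with
  | zero => simp [momentFunctional_X_pow]
  | succ l ih =>
    have : (X ^ k * (1 - X) ^ (l + 1) : ℝ[X]) =
        X ^ k * (1 - X) ^ l - X ^ (k + 1) * (1 - X) ^ l := by ring
    rw [this, map_sub, ih, ih, Function.iterate_succ_apply', seqDiff]

theorem CompletelyMonotoneSeq.momentFunctional_bernstein_nonneg {m : ℕ → ℝ}
    (h : CompletelyMonotoneSeq m) (N k : ℕ) :
    0 ≤ momentFunctional m (bernsteinPolynomial ℝ N k) := by
  have : bernsteinPolynomial ℝ N k = (N.choose k : ℝ) • (X ^ k * (1 - X) ^ (N - k)) := by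
    rw [bernsteinPolynomial, smul_eq_C_mul, mul_assoc]; simp
  rw [this, map_smul, momentFunctional_X_pow_mul, smul_eq_mul]
  exact mul_nonneg (Nat.cast_nonneg _) (h _ _)

/-- The factorial moments of the binomial distribution: terms with `k < j` vanish, and `C(N, k) C(k,
j) = C(N, j) C(N - j, k - j)` reduces the rest to the binomial theorem for `(X + (1 - X)) ^ (N -
j)`. -/
theorem sum_choose_smul_bernsteinPolynomial {j N : ℕ} (hj : j ≤ N) :
    ∑ k ∈ Finset.range (N + 1), (k.choose j : ℝ) • bernsteinPolynomial ℝ N k =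
      (N.choose j : ℝ) • X ^ j := by
  have hN : N + 1 = j + (N - j + 1) := by omega
  rw [hN, Finset.sum_range_add, Finset.sum_eq_zero, zero_add]
  · have h2 := add_pow (X : ℝ[X]) (1 - X) (N - j)
    rw [add_sub_cancel, one_pow] at h2
    calc _ = ∑ i ∈ Finset.range (N - j + 1),
          (N.choose j : ℝ[X]) * X ^ j * (X ^ i * (1 - X) ^ (N - j - i) * ((N - j).choose i : ℝ[X])) := by
          refine Finset.sum_congr rfl fun i hi => ?_
          rw [Finset.mem_range] at hi
          have h3 := Nat.choose_mul (n := N) (k := j + i) (s := j)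
            (by omega)
          have h4 : ((N.choose (j + i) : ℕ) : ℝ[X]) * ((j + i).choose j : ℕ) =
              (N.choose j : ℕ) * ((N - j).choose i : ℕ) := by
            rw [← Nat.cast_mul, h3, Nat.cast_mul, Nat.add_sub_cancel_left]
          rw [bernsteinPolynomial, smul_eq_C_mul, pow_add, Nat.sub_add_eq, C_eq_natCast]
          linear_combination X ^ j * X ^ i * (1 - X) ^ (N - j - i) * h4
      _ = _ := by rw [← Finset.mul_sum, ← h2, mul_one, smul_eq_C_mul, C_eq_natCast]
  · intro k hk
    rw [Nat.choose_eq_zero_of_lt (Finset.mem_range.1 hk)]; simp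

/-- An exact formula for `m j` by the Bernstein weights. It differs from the `j`-th moment of
`bernsteinMeasure` only in having falling factorial quotients in place of `(k / N) ^ j`. -/
theorem sum_choose_mul_momentFunctional (m : ℕ → ℝ) {j N : ℕ} (hj : j ≤ N) :
    ∑ k ∈ Finset.range (N + 1),
      ((k.descFactorial j : ℝ) / N.descFactorial j) *
        momentFunctional m (bernsteinPolynomial ℝ N k) = m j := by
  have h := congrArg (momentFunctional m) (sum_choose_smul_bernsteinPolynomial hj)
  simp only [map_sum, map_smul, momentFunctional_X_pow, smul_eq_mul] at h
  have hpos : (N.choose j : ℝ) ≠ 0 := by exact_mod_cast (Nat.choose_pos hj).ne'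
  have hf : (j.factorial : ℝ) ≠ 0 := by exact_mod_cast j.factorial_ne_zero
  rw [← mul_right_inj' hpos, ← h, Finset.mul_sum]
  refine Finset.sum_congr rfl fun k _ => ?_
  rw [Nat.descFactorial_eq_factorial_mul_choose, Nat.descFactorial_eq_factorial_mul_choose]
  push_cast
  field_simp

theorem abs_descFactorial_div_sub_pow_le {j N k : ℕ} (hj : j < N) (hk : k ≤ N) :
    |(k.descFactorial j : ℝ) / N.descFactorial j - ((k : ℝ) / N) ^ j| ≤
      (j : ℝ) ^ 2 / ((N : ℝ) - j) := by
  induction j with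
  | zero => simp
  | succ j ih =>
    have ih := ih (by omega)
    have hNj : (0 : ℝ) < (N : ℝ) - (j + 1 : ℕ) := by
      rw [sub_pos]; exact_mod_cast hj
    have hNj' : (0 : ℝ) < (N : ℝ) - j := by push_cast at hNj; linarith
    have hN : (0 : ℝ) < N := by exact_mod_cast (by omega : 0 < N)
    have hkN : (k : ℝ) ≤ N := by exact_mod_cast hk
    set u : ℝ := (k.descFactorial j : ℝ) / N.descFactorial j
    set v : ℝ := ((k : ℝ) / N) ^ j
    have hu : (k.descFactorial (j + 1) : ℝ) / N.descFactorial (j + 1) =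
        ((k - j : ℕ) : ℝ) / ((N : ℝ) - j) * u := by
      rw [Nat.descFactorial_succ, Nat.descFactorial_succ, Nat.cast_mul, Nat.cast_mul,
        Nat.cast_sub (show j ≤ N by omega), mul_div_mul_comm]
    have hv1 : |v| ≤ 1 := by
      rw [abs_of_nonneg (by positivity)]
      exact pow_le_one₀ (by positivity) (div_le_one_of_le₀ hkN hN.le)
    have hr1 : |((k - j : ℕ) : ℝ) / ((N : ℝ) - j)| ≤ 1 := by
      rw [abs_of_nonneg (by positivity), div_le_one hNj', ← Nat.cast_sub (show j ≤ N by omega)]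
      exact_mod_cast (by omega)
    -- The natural subtraction is zero when `k ≤ j`; the claim is then just `k / N ≤ j / (N - j)`.
    have hr : |((k - j : ℕ) : ℝ) / ((N : ℝ) - j) - (k : ℝ) / N| ≤ j / ((N : ℝ) - j) := by
      rcases le_total j k with h | h
      · have hjk : (j : ℝ) ≤ k := by exact_mod_cast h
        have : ((k - j : ℕ) : ℝ) / ((N : ℝ) - j) - (k : ℝ) / N =
            -(j / ((N : ℝ) - j) * (1 - k / N)) := by
          rw [Nat.cast_sub h]; field_simp; ring
        rw [this, abs_neg, abs_of_nonneg]
        · refine mul_le_of_le_one_right (by positivity) ?_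
          have : (0 : ℝ) ≤ k / N := by positivity
          linarith
        · have := div_le_one_of_le₀ hkN hN.le
          exact mul_nonneg (by positivity) (by linarith)
      · have hjk : (k : ℝ) ≤ j := by exact_mod_cast h
        rw [Nat.sub_eq_zero_of_le h, Nat.cast_zero, zero_div, zero_sub, abs_neg,
          abs_of_nonneg (by positivity)]
        exact div_le_div₀ (by positivity) hjk hNj' (by linarith [(Nat.cast_nonneg j : (0 : ℝ) ≤ j)])
    rw [hu, pow_succ']
    have hsplit : ((k - j : ℕ) : ℝ) / ((N : ℝ) - j) * u - (k : ℝ) / N * v =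
        ((k - j : ℕ) : ℝ) / ((N : ℝ) - j) * (u - v) +
          (((k - j : ℕ) : ℝ) / ((N : ℝ) - j) - (k : ℝ) / N) * v := by ring
    rw [hsplit]
    calc _ ≤ _ := abs_add_le _ _
      _ ≤ 1 * ((j : ℝ) ^ 2 / ((N : ℝ) - j)) + j / ((N : ℝ) - j) * 1 := by
        rw [abs_mul, abs_mul]
        exact add_le_add (mul_le_mul hr1 ih (abs_nonneg _) zero_le_one)
          (mul_le_mul hr hv1 (abs_nonneg _) (by positivity))
      _ = ((j : ℝ) ^ 2 + j) / ((N : ℝ) - j) := by ring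
      _ ≤ _ := by
        refine div_le_div₀ (by positivity) ?_ hNj ?_
        · push_cast; nlinarith [(Nat.cast_nonneg j : (0 : ℝ) ≤ j)]
        · push_cast; linarith

theorem integrable_unitInterval_of_continuous {E : Type*} [NormedAddCommGroup E]
    [SecondCountableTopology E] [MeasurableSpace E] [BorelSpace E] {f : unitInterval → E}
    (hf : Continuous f) (μ : Measure unitInterval) [IsFiniteMeasure μ] : Integrable f μ :=
  (BoundedContinuousFunction.mkOfCompact ⟨f, hf⟩).integrable μ

/-- The discrete measure with mass `momentFunctional m (bernsteinPolynomial ℝ N k)` at `k / N`. -/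
noncomputable def bernsteinMeasure (m : ℕ → ℝ) (N : ℕ) : Measure unitInterval :=
  ∑ k ∈ Finset.range (N + 1),
    ENNReal.ofReal (momentFunctional m (bernsteinPolynomial ℝ N k)) •
      Measure.dirac (Set.projIcc (0 : ℝ) 1 zero_le_one ((k : ℝ) / N))

theorem CompletelyMonotoneSeq.isProbabilityMeasure_bernsteinMeasure {m : ℕ → ℝ}
    (h : CompletelyMonotoneSeq m) (h0 : m 0 = 1) (N : ℕ) :
    IsProbabilityMeasure (bernsteinMeasure m N) := by
  constructor
  simp only [bernsteinMeasure, Measure.coe_finsetSum, Finset.sum_apply, Measure.smul_apply,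
    measure_univ, smul_eq_mul, mul_one]
  rw [← ENNReal.ofReal_sum_of_nonneg fun k _ => h.momentFunctional_bernstein_nonneg N k,
    ← map_sum, bernsteinPolynomial.sum, ← pow_zero X, momentFunctional_X_pow, h0,
    ENNReal.ofReal_one]

theorem CompletelyMonotoneSeq.integral_pow_bernsteinMeasure {m : ℕ → ℝ}
    (h : CompletelyMonotoneSeq m) {N : ℕ} (hN : 0 < N) (j : ℕ) :
    ∫ t, (t : ℝ) ^ j ∂(bernsteinMeasure m N) =
      ∑ k ∈ Finset.range (N + 1),
        ((k : ℝ) / N) ^ j * momentFunctional m (bernsteinPolynomial ℝ N k) := by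
  rw [bernsteinMeasure, integral_finsetSum_measure]
  · refine Finset.sum_congr rfl fun k hk => ?_
    have hN' : (0 : ℝ) < N := by exact_mod_cast hN
    have hk' : (k : ℝ) ≤ N := by exact_mod_cast Nat.lt_succ_iff.1 (Finset.mem_range.1 hk)
    rw [integral_smul_measure, integral_dirac,
      Set.projIcc_of_mem _ ⟨by positivity, div_le_one_of_le₀ hk' hN'.le⟩,
      ENNReal.toReal_ofReal (h.momentFunctional_bernstein_nonneg N k), smul_eq_mul, mul_comm]
  · intro k _
    exact (integrable_unitInterval_of_continuous (by fun_prop) _).smul_measure ENNReal.ofReal_ne_top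

theorem CompletelyMonotoneSeq.tendsto_integral_pow_bernsteinMeasure {m : ℕ → ℝ}
    (h : CompletelyMonotoneSeq m) (h0 : m 0 = 1) (j : ℕ) :
    Tendsto (fun N => ∫ t, (t : ℝ) ^ j ∂(bernsteinMeasure m N)) atTop (𝓝 (m j)) := by
  have hb : Tendsto (fun N : ℕ => (j : ℝ) ^ 2 / ((N : ℝ) - j)) atTop (𝓝 0) :=
    tendsto_const_nhds.div_atTop
      (tendsto_atTop_add_const_right _ (-(j : ℝ)) tendsto_natCast_atTop_atTop)
  rw [tendsto_iff_norm_sub_tendsto_zero]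
  refine squeeze_zero' (Eventually.of_forall fun _ => norm_nonneg _) ?_ hb
  filter_upwards [eventually_gt_atTop j] with N hN
  rw [h.integral_pow_bernsteinMeasure (by omega), ← sum_choose_mul_momentFunctional m hN.le,
    ← Finset.sum_sub_distrib]
  simp only [← sub_mul]
  calc _ ≤ ∑ k ∈ Finset.range (N + 1), (j : ℝ) ^ 2 / ((N : ℝ) - j) *
        momentFunctional m (bernsteinPolynomial ℝ N k) := by
        refine norm_sum_le_of_le _ fun k hk => ?_
        have hpos := h.momentFunctional_bernstein_nonneg N k
        rw [norm_mul, Real.norm_of_nonneg hpos, norm_sub_rev, Real.norm_eq_abs]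
        exact mul_le_mul_of_nonneg_right (abs_descFactorial_div_sub_pow_le hN
          (Nat.lt_succ_iff.1 (Finset.mem_range.1 hk))) hpos
    _ = _ := by
        rw [← Finset.mul_sum, ← map_sum, bernsteinPolynomial.sum, ← pow_zero X,
          momentFunctional_X_pow, h0, mul_one]

/-- **Hausdorff moment theorem**: a completely monotone sequence starting at `1` is the moment
sequence of a probability measure on the unit interval. -/
theorem CompletelyMonotoneSeq.exists_probabilityMeasure {m : ℕ → ℝ}
    (h : CompletelyMonotoneSeq m) (h0 : m 0 = 1) :
    ∃ μ : ProbabilityMeasure unitInterval,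
      ∀ n, ∫ t, (t : ℝ) ^ n ∂(μ : Measure unitInterval) = m n := by
  let ν : ℕ → ProbabilityMeasure unitInterval := fun N =>
    ⟨bernsteinMeasure m N, h.isProbabilityMeasure_bernsteinMeasure h0 N⟩
  -- Probability measures on a compact space form a compact space, so the discrete measures converge
  -- along any ultrafilter; a nonprincipal one keeps the limits of the moments.
  let U : Ultrafilter (ProbabilityMeasure unitInterval) := (hyperfilter ℕ).map ν
  have hU : Tendsto ν (hyperfilter ℕ) (𝓝 U.lim) := U.le_nhds_lim
  refine ⟨U.lim, fun n => ?_⟩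
  have h1 := ProbabilityMeasure.tendsto_iff_forall_integral_tendsto.1 hU
    (BoundedContinuousFunction.mkOfCompact ⟨fun t : unitInterval => (t : ℝ) ^ n, by fun_prop⟩)
  exact tendsto_nhds_unique h1
    ((h.tendsto_integral_pow_bernsteinMeasure h0 n).mono_left Nat.hyperfilter_le_atTop)

/-! ### Differences of the logarithm and majorization -/

/-- `k ! / (x (x + 1) ⋯ (x + k))`, the `k`-th iterated difference of `1 / x`. -/
noncomputable def reciprocalDiff (k : ℕ) (x : ℝ) : ℝ :=
  k.factorial / ∏ i ∈ Finset.range (k + 1), (x + i)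

/-- The `k`-th iterated difference of `-log`. -/
noncomputable def negLogDiff : ℕ → ℝ → ℝ
  | 0, x => -Real.log x
  | k + 1, x => negLogDiff k x - negLogDiff k (x + 1)

theorem prod_range_add_pos {x : ℝ} (hx : 0 < x) (k : ℕ) :
    0 < ∏ i ∈ Finset.range k, (x + i) :=
  Finset.prod_pos fun i _ => by positivity

theorem reciprocalDiff_pos {x : ℝ} (hx : 0 < x) (k : ℕ) : 0 < reciprocalDiff k x :=
  div_pos (by exact_mod_cast k.factorial_pos) (prod_range_add_pos hx _)

theorem strictAntiOn_reciprocalDiff (k : ℕ) : StrictAntiOn (reciprocalDiff k) (Set.Ioi 0) := by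
  intro x hx y hy hxy
  rw [Set.mem_Ioi] at hx hy
  refine div_lt_div_of_pos_left (by exact_mod_cast k.factorial_pos) (prod_range_add_pos hx _) ?_
  refine Finset.prod_lt_prod_of_nonempty (fun i _ => by positivity) (fun i _ => by linarith) ?_
  exact Finset.nonempty_range_iff.2 k.succ_ne_zero

theorem reciprocalDiff_succ {x : ℝ} (hx : 0 < x) (k : ℕ) :
    reciprocalDiff k x - reciprocalDiff k (x + 1) = reciprocalDiff (k + 1) x := by
  have h1 : ∏ i ∈ Finset.range (k + 1 + 1), (x + i) =
      (∏ i ∈ Finset.range (k + 1), (x + i)) * (x + (k + 1 : ℕ)) := Finset.prod_range_succ _ _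
  have h2 : ∏ i ∈ Finset.range (k + 1 + 1), (x + i) =
      (∏ i ∈ Finset.range (k + 1), (x + 1 + i)) * x := by
    rw [Finset.prod_range_succ']
    congr 1
    · exact Finset.prod_congr rfl fun i _ => by push_cast; ring
    · simp
  have p1 := prod_range_add_pos hx (k + 1)
  have p2 := prod_range_add_pos (show 0 < x + 1 by linarith) (k + 1)
  have p3 := prod_range_add_pos hx (k + 1 + 1)
  have e1 : reciprocalDiff k x = k.factorial * (x + (k + 1 : ℕ)) /
      ∏ i ∈ Finset.range (k + 1 + 1), (x + i) := by
    rw [reciprocalDiff, h1, mul_div_mul_right _ _ (by positivity)]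
  have e2 : reciprocalDiff k (x + 1) = k.factorial * x /
      ∏ i ∈ Finset.range (k + 1 + 1), (x + i) := by
    rw [reciprocalDiff, h2, mul_div_mul_right _ _ hx.ne']
  rw [e1, e2, ← sub_div, reciprocalDiff, Nat.factorial_succ]
  push_cast
  congr 1; ring

/-- Differencing commutes with differentiation. As `reciprocalDiff k` is positive and strictly
decreasing, `negLogDiff k` is decreasing and strictly convex on the positive half-line. -/
theorem hasDerivAt_negLogDiff (k : ℕ) {x : ℝ} (hx : 0 < x) :
    HasDerivAt (negLogDiff k) (-reciprocalDiff k x) x := by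
  induction k generalizing x with
  | zero =>
    have h0 : reciprocalDiff 0 x = x⁻¹ := by simp [reciprocalDiff]
    rw [h0]
    exact (Real.hasDerivAt_log hx.ne').neg
  | succ k ih =>
    have h1 : HasDerivAt (fun y => negLogDiff k (y + 1)) (-reciprocalDiff k (x + 1)) x :=
      (ih (show 0 < x + 1 by linarith)).comp_add_const x 1
    have h2 := (ih hx).sub h1
    rw [← reciprocalDiff_succ hx]
    convert! h2 using 1
    ring

/-- A function on the positive half-line with strictly increasing derivative lies strictly above
its tangent lines. -/
theorem tangent_lt_of_strictAntiOn {φ w : ℝ → ℝ} (hw : StrictAntiOn w (Set.Ioi 0))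
    (hφ : ∀ x, 0 < x → HasDerivAt φ (-w x) x) {a b : ℝ} (ha : 0 < a) (hb : 0 < b) (hab : a ≠ b) :
    w b * (b - a) < φ a - φ b := by
  rcases lt_or_gt_of_ne hab with h | h
  · obtain ⟨c, hc, hc'⟩ := exists_hasDerivAt_eq_slope φ (fun x => -w x) h
      (fun x hx => (hφ x (ha.trans_le hx.1)).continuousAt.continuousWithinAt)
      (fun x hx => hφ x (ha.trans hx.1))
    have h1 : w b < w c := hw (Set.mem_Ioi.2 (ha.trans hc.1)) hb hc.2
    rw [eq_div_iff (by linarith)] at hc'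
    nlinarith
  · obtain ⟨c, hc, hc'⟩ := exists_hasDerivAt_eq_slope φ (fun x => -w x) h
      (fun x hx => (hφ x (hb.trans_le hx.1)).continuousAt.continuousWithinAt)
      (fun x hx => hφ x (hb.trans hx.1))
    have h1 : w c < w b := hw hb (Set.mem_Ioi.2 (hb.trans hc.1)) hc.1
    rw [eq_div_iff (by linarith)] at hc'
    nlinarith

/-- A consequence of summation by parts: an antitone weight against a sequence with nonnegative
partial sums. -/
theorem mul_sum_le_sum_mul_of_antitone {q : ℕ} (w c : Fin q → ℝ) (hw : Antitone w)
    (hc : ∀ k, 0 ≤ ∑ i ∈ Finset.Iic k, c i) (v : ℝ) (hv : ∀ i, v ≤ w i) :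
    v * ∑ i, c i ≤ ∑ i, w i * c i := by
  induction q generalizing v with
  | zero => simp
  | succ q ih =>
    -- The last weight serves as the lower bound for the earlier ones; it can then be lowered to `v`
    -- because the total sum of `c` is nonnegative.
    have h1 := ih (fun i => w i.castSucc) (fun i => c i.castSucc)
      (fun i j hij => hw (Fin.castSucc_le_castSucc_iff.2 hij))
      (fun k => by rw [← Fin.sum_Iic_castSucc]; exact hc _) (w (Fin.last q))
      (fun i => hw (Fin.le_last _))
    have h2 := hc (Fin.last q)
    have h3 : Finset.Iic (Fin.last q) = Finset.univ := by ext i; simp [Fin.le_last]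
    rw [h3, Fin.sum_univ_castSucc] at h2
    rw [Fin.sum_univ_castSucc, Fin.sum_univ_castSucc]
    have := mul_le_mul_of_nonneg_right (hv (Fin.last q)) h2
    linarith

namespace WeaklySupermajorizedBy

variable {q : ℕ} {a b : Fin q → ℝ}

theorem sum_mul_sub_nonneg (h : WeaklySupermajorizedBy b a) {w : ℝ → ℝ}
    (hw : AntitoneOn w (Set.Ioi 0)) (hw0 : ∀ x, 0 < x → 0 ≤ w x) :
    0 ≤ ∑ i, w (b i) * (b i - a i) := by
  obtain ⟨-, -, hb, hbm, hs⟩ := h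
  simpa using mul_sum_le_sum_mul_of_antitone (fun i => w (b i)) (fun i => b i - a i)
    (fun i j hij => hw (hb i) (hb j) (hbm hij))
    (fun k => by rw [Finset.sum_sub_distrib]; exact sub_nonneg.2 (hs k)) 0 (fun i => hw0 _ (hb i))

/-- Weakly supermajorized tuples remain so after a common translation. -/
theorem add_const (h : WeaklySupermajorizedBy b a) {s : ℝ} (hs : 0 ≤ s) :
    WeaklySupermajorizedBy (fun i => b i + s) (fun i => a i + s) := by
  obtain ⟨ha, ham, hb, hbm, hsum⟩ := h
  refine ⟨fun i => by linarith [ha i], fun i j hij => by simpa using ham hij,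
    fun i => by linarith [hb i], fun i j hij => by simpa using hbm hij, fun k => ?_⟩
  rw [Finset.sum_add_distrib, Finset.sum_add_distrib]
  exact add_le_add (hsum k) le_rfl

/-- The tangent at `b i` bounds each summand below by `w (b i) * (b i - a i)`, with `w =
reciprocalDiff k`. These weights are nonnegative and decrease with `i`, so summation by parts
applies. -/
theorem sum_negLogDiff_sub_nonneg (h : WeaklySupermajorizedBy b a) (k : ℕ) :
    0 ≤ ∑ i, (negLogDiff k (a i) - negLogDiff k (b i)) := by
  refine (h.sum_mul_sub_nonneg (strictAntiOn_reciprocalDiff k).antitoneOn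
    fun x hx => (reciprocalDiff_pos hx k).le).trans (Finset.sum_le_sum fun i _ => ?_)
  rcases eq_or_ne (a i) (b i) with he | hne
  · simp [he]
  · exact (tangent_lt_of_strictAntiOn (strictAntiOn_reciprocalDiff k)
      (fun x hx => hasDerivAt_negLogDiff k hx) (h.1 i) (h.2.2.1 i) hne).le

theorem sum_negLogDiff_sub_pos (h : WeaklySupermajorizedBy b a) (hne : a ≠ b) (k : ℕ) :
    0 < ∑ i, (negLogDiff k (a i) - negLogDiff k (b i)) := by
  have ht : ∀ i, a i ≠ b i → reciprocalDiff k (b i) * (b i - a i) <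
      negLogDiff k (a i) - negLogDiff k (b i) := fun i hi =>
    tangent_lt_of_strictAntiOn (strictAntiOn_reciprocalDiff k)
      (fun x hx => hasDerivAt_negLogDiff k hx) (h.1 i) (h.2.2.1 i) hi
  refine (h.sum_mul_sub_nonneg (strictAntiOn_reciprocalDiff k).antitoneOn
    fun x hx => (reciprocalDiff_pos hx k).le).trans_lt (Finset.sum_lt_sum (fun i _ => ?_) ?_)
  · rcases eq_or_ne (a i) (b i) with he | hne
    · simp [he]
    · exact (ht i hne).le
  · obtain ⟨i, hi⟩ := Function.ne_iff.1 hne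
    exact ⟨i, Finset.mem_univ i, ht i hi⟩

end WeaklySupermajorizedBy

/-! ### Complete monotonicity of the Pochhammer ratios -/

/-- Minus the logarithm of `∏ (a i + n) / (b i + n)`. -/
noncomputable def negLogRatio {q : ℕ} (a b : Fin q → ℝ) (n : ℕ) : ℝ :=
  ∑ i, (negLogDiff 0 (a i + n) - negLogDiff 0 (b i + n))

theorem seqDiff_iterate_negLogRatio {q : ℕ} (a b : Fin q → ℝ) (k n : ℕ) :
    seqDiff^[k] (negLogRatio a b) n =
      ∑ i, (negLogDiff k (a i + n) - negLogDiff k (b i + n)) := by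
  induction k generalizing n with
  | zero => rfl
  | succ k ih =>
    simp only [Function.iterate_succ_apply', seqDiff, ih]
    rw [← Finset.sum_sub_distrib]
    refine Finset.sum_congr rfl fun i _ => ?_
    simp only [negLogDiff]
    push_cast
    rw [add_assoc, add_assoc]
    ring

theorem exp_neg_negLogRatio {q : ℕ} {a b : Fin q → ℝ} (ha : ∀ i, 0 < a i) (hb : ∀ i, 0 < b i)
    (n : ℕ) : Real.exp (-negLogRatio a b n) = ∏ i, (a i + n) / (b i + n) := by
  rw [negLogRatio, ← Finset.sum_neg_distrib, Real.exp_sum]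
  refine Finset.prod_congr rfl fun i _ => ?_
  have h1 : 0 < a i + n := add_pos_of_pos_of_nonneg (ha i) n.cast_nonneg
  have h2 : 0 < b i + n := add_pos_of_pos_of_nonneg (hb i) n.cast_nonneg
  rw [negLogDiff, negLogDiff, show -(-Real.log (a i + n) - -Real.log (b i + n)) =
    Real.log (a i + n) - Real.log (b i + n) by ring, Real.exp_sub, Real.exp_log h1,
    Real.exp_log h2]

/-- The ratio `∏ (a i)_n / (b i)_n` of rising factorials. -/
noncomputable def pochhammerRatio {q : ℕ} (a b : Fin q → ℝ) (n : ℕ) : ℝ :=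
  ∏ i, (ascPochhammer ℝ n).eval (a i) / (ascPochhammer ℝ n).eval (b i)

theorem pochhammerRatio_zero {q : ℕ} (a b : Fin q → ℝ) : pochhammerRatio a b 0 = 1 := by
  simp [pochhammerRatio]

theorem pochhammerRatio_succ {q : ℕ} (a b : Fin q → ℝ) (n : ℕ) :
    pochhammerRatio a b (n + 1) = pochhammerRatio a b n * ∏ i, (a i + n) / (b i + n) := by
  simp only [pochhammerRatio, ascPochhammer_succ_eval, mul_div_mul_comm, Finset.prod_mul_distrib]

theorem pochhammerRatio_one {q : ℕ} (a b : Fin q → ℝ) :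
    pochhammerRatio a b 1 = ∏ i, a i / b i := by
  simp [pochhammerRatio]

theorem pochhammerRatio_self {q : ℕ} {a : Fin q → ℝ} (ha : ∀ i, 0 < a i) (n : ℕ) :
    pochhammerRatio a a n = 1 :=
  Finset.prod_eq_one fun i _ => div_self (ascPochhammer_pos n (a i) (ha i)).ne'

namespace WeaklySupermajorizedBy

variable {q : ℕ} {a b : Fin q → ℝ}

theorem completelyMonotoneSeq_negLogRatio (h : WeaklySupermajorizedBy b a) :
    CompletelyMonotoneSeq (negLogRatio a b) := fun k n => by
  rw [seqDiff_iterate_negLogRatio]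
  exact (h.add_const n.cast_nonneg).sum_negLogDiff_sub_nonneg k

theorem completelyMonotoneSeq_pochhammerRatio (h : WeaklySupermajorizedBy b a) :
    CompletelyMonotoneSeq (pochhammerRatio a b) := by
  have : pochhammerRatio a b =
      fun n => ∏ j ∈ Finset.range n, Real.exp (-negLogRatio a b j) := by
    ext n
    induction n with
    | zero => exact pochhammerRatio_zero a b
    | succ n ih =>
      rw [pochhammerRatio_succ, Finset.prod_range_succ, ih, exp_neg_negLogRatio h.1 h.2.2.1]
  rw [this]
  exact h.completelyMonotoneSeq_negLogRatio.prod_exp_neg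

/-- With `g = negLogRatio a b` the first two moments are `exp (-g 0)` and `exp (-g 0 - g 1)`, and
the strict majorization inequality for first differences gives `g 1 < g 0`. The representing measure
therefore has positive variance. -/
theorem pochhammerRatio_two_ne (h : WeaklySupermajorizedBy b a) (hne : a ≠ b) :
    pochhammerRatio a b 2 ≠ pochhammerRatio a b 1 ^ 2 := by
  have h1 : negLogRatio a b 1 < negLogRatio a b 0 := by
    have h2 := seqDiff_iterate_negLogRatio a b 1 0
    have h3 := h.sum_negLogDiff_sub_pos hne 1
    simp only [Function.iterate_one, seqDiff, Nat.cast_zero, add_zero, zero_add] at h2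
    linarith
  have hpos : pochhammerRatio a b 1 ≠ 0 := by
    rw [pochhammerRatio_one]
    exact Finset.prod_ne_zero_iff.2 fun i _ => (div_pos (h.1 i) (h.2.2.1 i)).ne'
  have h4 : pochhammerRatio a b 1 = Real.exp (-negLogRatio a b 0) := by
    rw [exp_neg_negLogRatio h.1 h.2.2.1, pochhammerRatio_one]; simp
  intro he
  rw [show (2 : ℕ) = 1 + 1 from rfl, pochhammerRatio_succ, ← exp_neg_negLogRatio h.1 h.2.2.1,
    pow_succ, pow_one, mul_right_inj' hpos, h4, Real.exp_eq_exp] at he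
  linarith

end WeaklySupermajorizedBy

/-! ### The Stieltjes transform as analytic continuation -/

theorem isOpen_cutPlane : IsOpen cutPlane := by
  have : cutPlane = {z | z.re < 1} ∪ {z | z.im ≠ 0} := rfl
  rw [this]
  exact (isOpen_lt Complex.continuous_re continuous_const).union
    (isOpen_ne_fun Complex.continuous_im continuous_const)

/-- The cut plane is star-shaped about `0`, so `t z` avoids `[1, ∞)` and the principal power of `1 -
t z` is analytic in `z`. -/
theorem one_sub_mul_mem_slitPlane {z : ℂ} (hz : z ∈ cutPlane) (t : unitInterval) :
    1 - z * (t : ℝ) ∈ Complex.slitPlane := by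
  have ht0 := t.2.1
  have ht1 := t.2.2
  have h := (starConvex_zero_iff.1 starConvex_cutPlane) hz ht0 ht1
  simp only [cutPlane, Set.mem_ofPred_eq, Complex.smul_re, Complex.smul_im, smul_eq_mul] at h
  rw [Complex.mem_slitPlane_iff]
  refine h.imp (fun h => ?_) (fun h => ?_)
  · simp; linarith
  · simp only [Complex.sub_im, Complex.one_im, Complex.mul_im, Complex.ofReal_re,
      Complex.ofReal_im, mul_zero, zero_add, zero_sub, ne_eq, neg_eq_zero]
    rwa [mul_comm]

theorem continuousOn_one_sub_mul_cpow (c : ℂ) :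
    ContinuousOn (fun p : ℂ × unitInterval => (1 - p.1 * ((p.2 : ℝ) : ℂ)) ^ c)
      (cutPlane ×ˢ Set.univ) :=
  ContinuousOn.cpow_const (by fun_prop) fun p hp => one_sub_mul_mem_slitPlane hp.1 p.2

/-- The generalized Stieltjes transform `∫ (1 - z t) ^ c dμ(t)` of a measure on `[0, 1]`. -/
noncomputable def stieltjesTransform (μ : Measure unitInterval) (c z : ℂ) : ℂ :=
  ∫ t, (1 - z * ((t : ℝ) : ℂ)) ^ c ∂μ

theorem continuous_one_sub_mul_cpow {z : ℂ} (hz : z ∈ cutPlane) (c : ℂ) :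
    Continuous fun t : unitInterval => (1 - z * ((t : ℝ) : ℂ)) ^ c :=
  (continuousOn_one_sub_mul_cpow c).comp_continuous (f := fun t => (z, t)) (by fun_prop)
    fun _ => ⟨hz, trivial⟩

theorem analyticOnNhd_stieltjesTransform (μ : Measure unitInterval) [IsFiniteMeasure μ] (c : ℂ) :
    AnalyticOnNhd ℂ (stieltjesTransform μ c) cutPlane := by
  refine DifferentiableOn.analyticOnNhd (fun z hz => ?_) isOpen_cutPlane
  obtain ⟨K, hKc, hzK, hK⟩ := exists_compact_subset isOpen_cutPlane hz
  let D : ℂ → unitInterval → ℂ := fun z t =>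
    c * (1 - z * ((t : ℝ) : ℂ)) ^ (c - 1) * -((t : ℝ) : ℂ)
  have hD : ContinuousOn (fun p : ℂ × unitInterval => D p.1 p.2) (cutPlane ×ˢ Set.univ) :=
    ((continuousOn_one_sub_mul_cpow (c - 1)).const_mul c).mul (by fun_prop)
  -- Joint continuity on the compact set `K × [0, 1]` gives a constant dominating the
  -- `z`-derivative, which allows differentiation under the integral.
  obtain ⟨C, hC⟩ := (hKc.prod (isCompact_univ (X := unitInterval))).exists_bound_of_continuousOn
    (hD.mono (Set.prod_mono hK subset_rfl))
  have hDz : Continuous (D z) :=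
    hD.comp_continuous (f := fun t => (z, t)) (by fun_prop) fun _ => ⟨hz, trivial⟩
  refine (hasDerivAt_integral_of_dominated_loc_of_deriv_le (F' := D) (bound := fun _ => C)
    (s := interior K) (isOpen_interior.mem_nhds hzK) ?_ ?_ ?_ ?_ ?_
    ?_).2.differentiableAt.differentiableWithinAt
  · filter_upwards [isOpen_cutPlane.mem_nhds hz] with w hw
    exact (continuous_one_sub_mul_cpow hw c).aestronglyMeasurable
  · exact integrable_unitInterval_of_continuous (continuous_one_sub_mul_cpow hz c) μ
  · exact hDz.aestronglyMeasurable
  · exact Eventually.of_forall fun t w hw => hC (w, t) ⟨interior_subset hw, trivial⟩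
  · exact integrable_const C
  · refine Eventually.of_forall fun t w hw => ?_
    refine HasDerivAt.cpow_const ?_ (one_sub_mul_mem_slitPlane (hK (interior_subset hw)) t)
    simpa using ((hasDerivAt_id w).mul_const ((t : ℝ) : ℂ)).const_sub 1

theorem Ring.choose_add_sub_one_eq_ascPochhammer (σ : ℂ) (n : ℕ) :
    Ring.choose (σ + n - 1) n = (ascPochhammer ℂ n).eval σ / n.factorial := by
  have hn : (n.factorial : ℂ) ≠ 0 := by exact_mod_cast n.factorial_ne_zero
  rw [eq_div_iff hn, Ring.choose, show σ + n - 1 - n + 1 = σ by ring, mul_comm, ← nsmul_eq_mul,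
    Ring.factorial_nsmul_multichoose_eq_ascPochhammer, Polynomial.ascPochhammer_smeval_eq_eval]

theorem hasSum_one_sub_cpow_neg (σ : ℂ) {z : ℂ} (hz : ‖z‖ < 1) :
    HasSum (fun n : ℕ => (ascPochhammer ℂ n).eval σ / n.factorial * z ^ n) ((1 - z) ^ (-σ)) := by
  have h := (Complex.one_div_one_sub_cpow_hasFPowerSeriesOnBall_zero σ).hasSum (y := z)
    (by rw [← ENNReal.ofReal_one, Metric.eball_ofReal]; simpa using hz)
  simp only [FormalMultilinearSeries.ofScalars_apply_eq, zero_add, smul_eq_mul,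
    Ring.choose_add_sub_one_eq_ascPochhammer, one_div] at h
  rwa [Complex.cpow_neg]

/-- For `t` in `[0, 1]` the binomial series in `z t` is dominated term by term by the absolutely
convergent one in `z`, so sum and integral may be exchanged. -/
theorem hasSum_stieltjesTransform (μ : Measure unitInterval) [IsFiniteMeasure μ] (σ : ℂ) {z : ℂ}
    (hz : ‖z‖ < 1) :
    HasSum (fun n : ℕ => (ascPochhammer ℂ n).eval σ / n.factorial *
      ((∫ t, (t : ℝ) ^ n ∂μ : ℝ) : ℂ) * z ^ n) (stieltjesTransform μ (-σ) z) := by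
  have hle : ∀ t : unitInterval, ‖((t : ℝ) : ℂ)‖ ≤ 1 := fun t => by
    rw [Complex.norm_real, Real.norm_of_nonneg t.2.1]; exact t.2.2
  let G : ℕ → unitInterval → ℂ := fun n t =>
    (ascPochhammer ℂ n).eval σ / n.factorial * (z * ((t : ℝ) : ℂ)) ^ n
  have hG : ∀ n, Integrable (G n) μ := fun n =>
    integrable_unitInterval_of_continuous (by fun_prop) μ
  have hS : Summable fun n : ℕ => ‖(ascPochhammer ℂ n).eval σ / n.factorial * z ^ n‖ :=
    (hasSum_one_sub_cpow_neg σ hz).summable.norm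
  have hGb : ∀ n t, ‖G n t‖ ≤ ‖(ascPochhammer ℂ n).eval σ / n.factorial * z ^ n‖ := fun n t => by
    simp only [G, mul_pow, ← mul_assoc]
    rw [norm_mul, norm_pow]
    exact mul_le_of_le_one_right (norm_nonneg _) (pow_le_one₀ (norm_nonneg _) (hle t))
  have h := hasSum_integral_of_summable_integral_norm hG <|
    (hS.mul_right (μ.real Set.univ)).of_nonneg_of_le
      (fun n => integral_nonneg fun t => norm_nonneg _) fun n => by
        refine (integral_mono (hG n).norm (integrable_const _) (hGb n)).trans_eq ?_
        rw [integral_const, smul_eq_mul, mul_comm]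
  have h1 : (fun n => ∫ t, G n t ∂μ) = fun n : ℕ => (ascPochhammer ℂ n).eval σ / n.factorial *
      ((∫ t, (t : ℝ) ^ n ∂μ : ℝ) : ℂ) * z ^ n := by
    ext n
    have : ∀ t, G n t = (ascPochhammer ℂ n).eval σ / n.factorial * z ^ n *
        (((t : ℝ) ^ n : ℝ) : ℂ) := fun t => by
      simp only [G, mul_pow, Complex.ofReal_pow]; ring
    simp only [this]
    rw [integral_const_mul, integral_complex_ofReal]
    ring
  have h2 : ∫ t, ∑' n, G n t ∂μ = stieltjesTransform μ (-σ) z := by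
    refine integral_congr_ae (Eventually.of_forall fun t => ?_)
    refine (hasSum_one_sub_cpow_neg σ ?_).tsum_eq
    rw [norm_mul]
    exact (mul_le_of_le_one_right (norm_nonneg _) (hle t)).trans_lt hz
  rwa [h1, h2] at h

theorem ofReal_ascPochhammer_eval (n : ℕ) (x : ℝ) :
    (ascPochhammer ℂ n).eval (x : ℂ) = ((ascPochhammer ℝ n).eval x : ℝ) := by
  rw [ascPochhammer_eval₂ Complex.ofRealHom]
  exact eval₂_at_apply Complex.ofRealHom x

theorem hypergeometricCoeff_ofReal {q : ℕ} (σ : ℂ) (a b : Fin q → ℝ) (n : ℕ) :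
    hypergeometricCoeff σ (fun i => (a i : ℂ)) (fun i => (b i : ℂ)) n =
      (ascPochhammer ℂ n).eval σ / n.factorial * (pochhammerRatio a b n : ℂ) := by
  simp only [hypergeometricCoeff, pochhammerRatio, ofReal_ascPochhammer_eval, Complex.ofReal_prod,
    Complex.ofReal_div, Finset.prod_div_distrib]
  rw [mul_comm (∏ i, _) (n.factorial : ℂ), mul_div_mul_comm]

theorem isHypergeometricContinuation_stieltjesTransform {q : ℕ} (σ : ℂ) {a b : Fin q → ℝ}
    {μ : Measure unitInterval} [IsFiniteMeasure μ]
    (hμ : ∀ n, ∫ t, (t : ℝ) ^ n ∂μ = pochhammerRatio a b n) :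
    IsHypergeometricContinuation σ (fun i => (a i : ℂ)) (fun i => (b i : ℂ))
      (stieltjesTransform μ (-σ)) := by
  refine ⟨analyticOnNhd_stieltjesTransform μ _, fun z hz => ?_⟩
  simpa only [hμ, hypergeometricCoeff_ofReal] using hasSum_stieltjesTransform μ σ hz

/-! ### Jensen's inequality and the equality case -/

theorem one_add_mul_pos {x : ℝ} (hx : -1 < x) (t : unitInterval) : 0 < 1 + x * (t : ℝ) := by
  rcases le_total 0 x with h | h
  · nlinarith [t.2.1]
  · nlinarith [t.2.2]

theorem stieltjesTransform_neg_ofReal (μ : Measure unitInterval) (c : ℝ) {x : ℝ} (hx : -1 < x) :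
    stieltjesTransform μ c (-(x : ℂ)) = ((∫ t, (1 + x * (t : ℝ)) ^ c ∂μ : ℝ) : ℂ) := by
  rw [stieltjesTransform, ← integral_complex_ofReal]
  refine integral_congr_ae (Eventually.of_forall fun t => ?_)
  simp only
  rw [Complex.ofReal_cpow (one_add_mul_pos hx t).le]
  push_cast
  rw [neg_mul, sub_neg_eq_add]

theorem strictConvexOn_rpow_neg {σ : ℝ} (hσ : 0 < σ) :
    StrictConvexOn ℝ (Set.Ioi 0) fun u : ℝ => u ^ (-σ) := by
  refine StrictMonoOn.strictConvexOn_of_deriv (convex_Ioi 0)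
    (fun u hu => (Real.continuousAt_rpow_const u _ (Or.inl (ne_of_gt hu))).continuousWithinAt) ?_
  rw [interior_Ioi]
  intro u hu v hv huv
  rw [Real.deriv_rpow_const, Real.deriv_rpow_const]
  have := Real.rpow_lt_rpow_of_neg hu huv (show -σ - 1 < 0 by linarith)
  nlinarith

theorem continuous_one_add_mul_rpow {x : ℝ} (hx : -1 < x) (c : ℝ) :
    Continuous fun t : unitInterval => (1 + x * (t : ℝ)) ^ c :=
  Continuous.rpow_const (by fun_prop) fun t => Or.inl (one_add_mul_pos hx t).ne'

theorem integral_one_add_mul (μ : Measure unitInterval) [IsProbabilityMeasure μ] (x : ℝ) :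
    ∫ t, (1 + x * (t : ℝ)) ∂μ = 1 + x * ∫ t, (t : ℝ) ∂μ := by
  rw [integral_add (integrable_const _)
    (integrable_unitInterval_of_continuous (by fun_prop) μ), integral_const_mul]
  simp

/-- Jensen's inequality for `(1 + x t) ^ (-σ)`, with strictness unless the second moment is the
square of the first. -/
theorem rpow_neg_integral_le_and_lt (μ : Measure unitInterval) [IsProbabilityMeasure μ] {σ x : ℝ}
    (hσ : 0 < σ) (hx : -1 < x) :
    (1 + x * ∫ t, (t : ℝ) ∂μ) ^ (-σ) ≤ ∫ t, (1 + x * (t : ℝ)) ^ (-σ) ∂μ ∧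
    (x ≠ 0 → ∫ t, (t : ℝ) ^ 2 ∂μ ≠ (∫ t, (t : ℝ) ∂μ) ^ 2 →
      (1 + x * ∫ t, (t : ℝ) ∂μ) ^ (-σ) < ∫ t, (1 + x * (t : ℝ)) ^ (-σ) ∂μ) := by
  -- Jensen's inequality is applied on a closed convex set; `min 1 (1 + x)` is the least value of `1
  -- + x t` on `[0, 1]`, so this half-line contains the range and stays away from `0`.
  have hpos : 0 < min 1 (1 + x) := lt_min one_pos (by linarith)
  have hsub : Set.Ici (min 1 (1 + x)) ⊆ Set.Ioi 0 := fun u hu => hpos.trans_le hu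
  have hconv := (strictConvexOn_rpow_neg hσ).subset hsub (convex_Ici _)
  have hcont : ContinuousOn (fun u : ℝ => u ^ (-σ)) (Set.Ici (min 1 (1 + x))) := fun u hu =>
    (Real.continuousAt_rpow_const u _ (Or.inl (ne_of_gt (hsub hu)))).continuousWithinAt
  have hmem : ∀ᵐ t ∂μ, 1 + x * ((t : unitInterval) : ℝ) ∈ Set.Ici (min 1 (1 + x)) :=
    Eventually.of_forall fun t => by
      rw [Set.mem_Ici, min_le_iff]
      rcases le_total 0 x with h | h
      · left; nlinarith [t.2.1]
      · right; nlinarith [t.2.2]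
  have hfi : Integrable (fun t : unitInterval => 1 + x * (t : ℝ)) μ :=
    integrable_unitInterval_of_continuous (by fun_prop) μ
  have hgi : Integrable ((fun u : ℝ => u ^ (-σ)) ∘ fun t : unitInterval => 1 + x * (t : ℝ)) μ :=
    integrable_unitInterval_of_continuous (continuous_one_add_mul_rpow hx _) μ
  rw [← integral_one_add_mul]
  refine ⟨hconv.convexOn.map_integral_le hcont isClosed_Ici hmem hfi hgi, fun hx0 hne => ?_⟩
  have h := hconv.ae_eq_const_or_map_average_lt hcont isClosed_Ici hmem hfi hgi
  simp only [average_eq_integral] at h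
  refine h.resolve_left fun hc => hne ?_
  rw [integral_one_add_mul] at hc
  -- If `1 + x t` is almost everywhere constant and `x ≠ 0`, then `t` equals its mean almost
  -- everywhere and the variance vanishes.
  have hc' : ∀ᵐ t ∂μ, ((t : unitInterval) : ℝ) ^ 2 = (∫ s, (s : ℝ) ∂μ) ^ 2 := by
    filter_upwards [hc] with t ht
    simp only [Function.const_apply] at ht
    rw [mul_left_cancel₀ hx0 (add_left_cancel ht)]
  rw [integral_congr_ae hc']
  simp

/-- The function `1 - t` is nonnegative with zero integral, so `μ` is concentrated at `t = 1`. This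
is the case of equal tuples. -/
theorem integral_one_add_mul_rpow_of_integral_eq_one (μ : Measure unitInterval)
    [IsProbabilityMeasure μ] (h : ∫ t, (t : ℝ) ∂μ = 1) (x c : ℝ) :
    ∫ t, (1 + x * (t : ℝ)) ^ c ∂μ = (1 + x) ^ c := by
  have hi : Integrable (fun t : unitInterval => (t : ℝ)) μ :=
    integrable_unitInterval_of_continuous (by fun_prop) μ
  have h0 : ∫ t, (1 - (t : ℝ)) ∂μ = 0 := by
    rw [integral_sub (integrable_const _) hi, h]; simp
  have h1 := (integral_eq_zero_iff_of_nonneg (fun t : unitInterval => sub_nonneg.2 t.2.2)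
    ((integrable_const _).sub hi)).1 h0
  have h2 : ∀ᵐ t ∂μ, (1 + x * ((t : unitInterval) : ℝ)) ^ c = (1 + x) ^ c := by
    filter_upwards [h1] with t ht
    have : (t : ℝ) = 1 := (sub_eq_zero.1 ht).symm
    rw [this, mul_one]
  rw [integral_congr_ae h2]
  simp

theorem mainTheorem4 {q : ℕ} (σ : ℝ) (a b : Fin q → ℝ) (hσ : 0 < σ)
    (hba : WeaklySupermajorizedBy b a) :
    IsHypergeometricContinuation (σ : ℂ) (fun i => (a i : ℂ)) (fun i => (b i : ℂ))
      (hypergeometric (σ : ℂ) (fun i => (a i : ℂ)) (fun i => (b i : ℂ))) ∧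
    ∀ x : ℝ, -1 < x →
      (hypergeometric (σ : ℂ) (fun i => (a i : ℂ)) (fun i => (b i : ℂ)) (-(x : ℂ))).im = 0 ∧
      1 / (1 + x * ∏ i, a i / b i) ^ σ ≤
        (hypergeometric (σ : ℂ) (fun i => (a i : ℂ)) (fun i => (b i : ℂ)) (-(x : ℂ))).re ∧
      (1 / (1 + x * ∏ i, a i / b i) ^ σ =
        (hypergeometric (σ : ℂ) (fun i => (a i : ℂ)) (fun i => (b i : ℂ)) (-(x : ℂ))).re ↔
          x = 0 ∨ a = b) := by
  obtain ⟨μ, hμ⟩ := hba.completelyMonotoneSeq_pochhammerRatio.exists_probabilityMeasure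
    (pochhammerRatio_zero a b)
  have hF := isHypergeometricContinuation_stieltjesTransform (σ : ℂ) hμ
  refine ⟨?_, fun x hx => ?_⟩
  · rw [hypergeometric, dif_pos ⟨_, hF⟩]
    exact Exists.choose_spec (⟨_, hF⟩ : ∃ F, IsHypergeometricContinuation _ _ _ F)
  have hmem : -(x : ℂ) ∈ cutPlane := Or.inl (by simp; linarith)
  have hval : hypergeometric (σ : ℂ) (fun i => (a i : ℂ)) (fun i => (b i : ℂ)) (-(x : ℂ)) =
      ((∫ t, (1 + x * (t : ℝ)) ^ (-σ) ∂(μ : Measure unitInterval) : ℝ) : ℂ) := by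
    rw [hypergeometric_eqOn hF hmem, ← Complex.ofReal_neg, stieltjesTransform_neg_ofReal _ _ hx]
  have hm1 : ∫ t, (t : ℝ) ∂(μ : Measure unitInterval) = pochhammerRatio a b 1 := by
    simpa using hμ 1
  obtain ⟨hle, hlt⟩ := rpow_neg_integral_le_and_lt (μ : Measure unitInterval) hσ hx
  rw [hm1] at hle hlt
  rw [hμ 2] at hlt
  -- Nonnegativity of the base is what permits rewriting the reciprocal of the `σ`-th power as a
  -- `-σ`-th power.
  have hpos : 0 ≤ 1 + x * pochhammerRatio a b 1 := by
    rw [← hm1, ← integral_one_add_mul]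
    exact integral_nonneg fun t => (one_add_mul_pos hx t).le
  rw [hval, Complex.ofReal_im, Complex.ofReal_re, ← pochhammerRatio_one, one_div,
    ← Real.rpow_neg hpos]
  refine ⟨rfl, hle, fun he => ?_, ?_⟩
  · by_contra! hcon
    exact (hlt hcon.1 (hba.pochhammerRatio_two_ne hcon.2)).ne he
  · rintro (rfl | rfl)
    · simp
    · rw [pochhammerRatio_self hba.1] at hm1 ⊢
      rw [integral_one_add_mul_rpow_of_integral_eq_one _ hm1, mul_one]
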